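/- Let $\mathbb{F}_q$ be a finite field with $q$ elements and let $n\ge 0$. Write $\operatorname{BT}(\mathbb{F}_q^n)$ for the poset of proper nonzero subspaces of $\mathbb{F}_q^n$, ordered by inclusion, with the action of $\operatorname{GL}_n(\mathbb{F}_q)$ given by $W\mapsto g(W)$. Let $\operatorname{St}=\tilde{\operatorname{H}}_{n-2}(\operatorname{BT}(\mathbb{F}_q^n),\mathbb{Z})$ be the integral Steinberg module: the reduced integral homology in degree $n-2$ of the order complex of this poset (the simplicial complex of its finite nonempty chains), with the induced action of $\operatorname{GL}_n(\mathbb{F}_q)$; here the reduced homology of the empty complex is $\mathbb{Z}$ in degree $-1$ and zero in all other degrees. Let $R$ be a (unital, associative, not necessarily commutative) ring in which the image of the integer $\prod_{k=1}^n (q^k-1)$ is invertible. Then $\operatorname{St}\otimes_{\mathbb{Z}} R$ is a projective (left) $R[\operatorname{GL}_n(\mathbb{F}_q)]$-module, where $R$ acts through the factor $R$ and $\operatorname{GL}_n(\mathbb{F}_q)$ acts through the factor $\operatorname{St}$. -/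

import Mathlib

open scoped TensorProduct

noncomputable section

namespace OrderComplex

/-- The `i`-dimensional faces of the order complex of a poset `P`: the finite chains in `P` with
`i + 1` elements. The empty chain is the unique face of dimension `-1`, and there are no faces
of dimension `< -1`. -/
def Face (P : Type*) [PartialOrder P] (i : ℤ) : Type _ :=
  {s : Finset P // IsChain (· ≤ ·) (s : Set P) ∧ (s.card : ℤ) = i + 1}

/-- The augmented integral simplicial chain group in degree `i`. -/
abbrev Chains (P : Type*) [PartialOrder P] (i : ℤ) : Type _ := Face P i →₀ ℤ

section

variable {P : Type*} [PartialOrder P] {i j k : ℤ}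

open Classical in
/-- The facet of the face `s` opposite to its vertex `x`. -/
def Face.erase (h : j + 1 = i) (s : Face P i) (x : s.1) : Face P j :=
  ⟨s.1.erase (x : P), s.2.1.mono (Finset.coe_subset.2 (Finset.erase_subset (x : P) s.1)), by
    have h1 := Finset.card_erase_add_one x.2
    have h2 := s.2.2
    omega⟩

open Classical in
/-- The number of vertices of `s` below `x`: the position of `x` in the chain `s`, counted
from `0`. -/
def Face.position (s : Face P i) (x : P) : ℕ := (s.1.filter (· < x)).card

/-- The simplicial boundary `∑ₘ (-1)ᵐ [x₀ < ⋯ < x̂ₘ < ⋯ < xᵢ]` of the face `[x₀ < ⋯ < xᵢ]`. -/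
def Face.boundary (h : j + 1 = i) (s : Face P i) : Chains P j :=
  ∑ x : s.1, (-1 : ℤ) ^ s.position x • Finsupp.single (s.erase h x) 1

/-- The boundary map of the augmented simplicial chain complex of the order complex. In degree
zero it is the augmentation: it maps each vertex to the empty face. -/
def boundary (P : Type*) [PartialOrder P] {i j : ℤ} (h : j + 1 = i) :
    Chains P i →ₗ[ℤ] Chains P j :=
  Finsupp.linearCombination ℤ (Face.boundary h)

/-- The image of a face under an order automorphism. -/
def Face.map (e : P ≃o P) (s : Face P i) : Face P i :=
  ⟨s.1.map e.toEquiv.toEmbedding, by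
    rw [Finset.coe_map]
    rintro _ ⟨a, ha, rfl⟩ _ ⟨b, hb, rfl⟩ hab
    have hne : a ≠ b := fun h => hab (h ▸ rfl)
    exact (s.2.1 ha hb hne).imp (fun h => e.monotone h) (fun h => e.monotone h), by
    rw [Finset.card_map]; exact s.2.2⟩

/-- The map induced on simplicial chains by an order automorphism. -/
def chainsMap (i : ℤ) (e : P ≃o P) : Chains P i →ₗ[ℤ] Chains P i :=
  Finsupp.lmapDomain ℤ ℤ (Face.map e)

theorem Face.boundary_map (h : j + 1 = i) (e : P ≃o P) (s : Face P i) :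
    (s.map e).boundary h = chainsMap j e (s.boundary h) := by
  classical
  have hmem : ∀ x : P, e x ∈ (s.map e).1 ↔ x ∈ s.1 := fun x =>
    Finset.mem_map' e.toEquiv.toEmbedding
  let f : s.1 ≃ (s.map e).1 := e.toEquiv.subtypeEquiv fun x => (hmem x).symm
  unfold Face.boundary
  rw [map_sum]
  refine (Fintype.sum_equiv f _ _ fun x => ?_).symm
  rw [map_smul]
  congr 1
  · congr 1
    unfold Face.position
    have : (s.map e).1.filter (· < e x) = (s.1.filter (· < (x : P))).map e.toEquiv.toEmbedding := by
      ext y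
      obtain ⟨z, rfl⟩ := e.surjective y
      have := Finset.mem_map' e.toEquiv.toEmbedding (a := z) (s := s.1.filter (· < (x : P)))
      simp only [Finset.mem_filter, hmem, e.lt_iff_lt]
      exact (this.trans (by simp)).symm
    exact (congrArg Finset.card this).symm ▸ (Finset.card_map _).symm
  · unfold chainsMap
    rw [Finsupp.lmapDomain_apply, Finsupp.mapDomain_single]
    congr 1
    apply Subtype.ext
    have := Finset.map_erase e.toEquiv.toEmbedding s.1 (x : P)
    unfold Face.map Face.erase
    convert this
    rfl

theorem boundary_chainsMap (h : j + 1 = i) (e : P ≃o P) (c : Chains P i) :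
    boundary P h (chainsMap i e c) = chainsMap j e (boundary P h c) := by
  have : boundary P h ∘ₗ chainsMap i e = chainsMap j e ∘ₗ boundary P h := by
    ext s : 2
    simpa [boundary, chainsMap] using Face.boundary_map h e s
  exact LinearMap.congr_fun this c

/-- The cycles of degree `i`. -/
def cycles (P : Type*) [PartialOrder P] (i : ℤ) : Submodule ℤ (Chains P i) :=
  LinearMap.ker (boundary P (sub_add_cancel i 1))

/-- The boundaries of degree `i`. -/
def boundaries (P : Type*) [PartialOrder P] (i : ℤ) : Submodule ℤ (Chains P i) :=
  LinearMap.range (boundary P (rfl : i + 1 = i + 1))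

theorem Face.position_erase (h : j + 1 = i) (s : Face P i) (x : s.1) (y : P) [Decidable (x.1 < y)] :
    (s.erase h x).position y + (if x.1 < y then 1 else 0) = s.position y := by
  classical
  unfold Face.position
  have : (s.erase h x).1.filter (· < y) = (s.1.filter (· < y)).erase x.1 := by
    unfold Face.erase
    ext z
    simp only [Finset.mem_filter, Finset.mem_erase]
    tauto
  split_ifs with hxy
  · rw [this]
    exact Finset.card_erase_add_one (Finset.mem_filter.2 ⟨x.2, hxy⟩)
  · rw [this, Finset.erase_eq_of_notMem, add_zero]
    simp [hxy]

theorem Face.boundary_boundary (h : j + 1 = i) (h' : k + 1 = j) (s : Face P i) :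
    OrderComplex.boundary P h' (s.boundary h) = 0 := by
  classical
  have e1 : OrderComplex.boundary P h' (s.boundary h) =
      ∑ p : Σ x : s.1, (s.erase h x).1,
        ((-1 : ℤ) ^ s.position p.1 * (-1 : ℤ) ^ (s.erase h p.1).position p.2) •
          Finsupp.single ((s.erase h p.1).erase h' p.2) (1 : ℤ) := by
    rw [Fintype.sum_sigma]
    unfold Face.boundary OrderComplex.boundary
    rw [map_sum]
    refine Finset.sum_congr rfl fun x _ => ?_
    rw [map_smul, Finsupp.linearCombination_single, one_smul]
    unfold Face.boundary
    rw [Finset.smul_sum]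
    refine Finset.sum_congr rfl fun y _ => ?_
    rw [smul_smul]
  rw [e1]
  have hm : ∀ (x : s.1) (y : P), y ∈ (s.erase h x).1 ↔ y ≠ x.1 ∧ y ∈ s.1 := fun x y => by
    unfold Face.erase
    simp only [Finset.mem_erase]
  refine Finset.sum_involution
    (fun p _ => ⟨⟨p.2.1, ((hm _ _).1 p.2.2).2⟩,
      ⟨p.1.1, (hm _ _).2 ⟨((hm _ _).1 p.2.2).1.symm, p.1.2⟩⟩⟩) ?_ ?_ ?_ ?_
  · rintro ⟨⟨x, hx⟩, ⟨y, hy⟩⟩ -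
    obtain ⟨hyx, hys⟩ := (hm _ _).1 hy
    have hf : (s.erase h ⟨x, hx⟩).erase h' ⟨y, hy⟩ = (s.erase h ⟨y, hys⟩).erase h'
        ⟨x, (hm _ _).2 ⟨hyx.symm, hx⟩⟩ := by
      apply Subtype.ext
      exact Finset.erase_right_comm
    have p1 := s.position_erase h ⟨x, hx⟩ y
    have p2 := s.position_erase h ⟨y, hys⟩ x
    dsimp only at p1 p2 ⊢
    rw [hf, ← add_smul]
    convert zero_smul ℤ _
    rw [← p1, ← p2]
    rcases s.2.1 hx hys hyx.symm with hle | hle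
    · have hlt := lt_of_le_of_ne hle hyx.symm
      rw [if_pos hlt, if_neg hlt.not_gt]
      ring
    · have hlt := lt_of_le_of_ne hle hyx
      rw [if_pos hlt, if_neg hlt.not_gt]
      ring
  · rintro ⟨⟨x, hx⟩, ⟨y, hy⟩⟩ - - heq
    exact ((hm _ _).1 hy).1 (congrArg (fun p => p.1.1) heq)
  · intros
    exact Finset.mem_univ _
  · intros
    rfl

/-- Consecutive boundary maps compose to zero. -/
theorem boundary_boundary (h : j + 1 = i) (h' : k + 1 = j) (c : Chains P i) :
    boundary P h' (boundary P h c) = 0 := by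
  have : boundary P h' ∘ₗ boundary P h = 0 := by
    ext s : 2
    simpa [boundary] using Face.boundary_boundary h h' s
  exact LinearMap.congr_fun this c

theorem boundaries_le_cycles (P : Type*) [PartialOrder P] (i : ℤ) :
    boundaries P i ≤ cycles P i := by
  rintro _ ⟨c, rfl⟩
  exact boundary_boundary _ _ c

/-- The reduced integral homology in degree `i` of the order complex of a poset `P`. -/
abbrev ReducedHomology (P : Type*) [PartialOrder P] (i : ℤ) : Type _ :=
  cycles P i ⧸ (boundaries P i).submoduleOf (cycles P i)

theorem chainsMap_mem_cycles (e : P ≃o P) {c : Chains P i} (hc : c ∈ cycles P i) :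
    chainsMap i e c ∈ cycles P i := by
  unfold cycles at *
  rw [LinearMap.mem_ker] at *
  rw [boundary_chainsMap, hc, map_zero]

/-- The map induced on cycles by an order automorphism. -/
def cyclesMap (i : ℤ) (e : P ≃o P) : cycles P i →ₗ[ℤ] cycles P i :=
  (chainsMap i e).restrict fun _ hc => chainsMap_mem_cycles e hc

theorem boundaries_le_comap (i : ℤ) (e : P ≃o P) :
    (boundaries P i).submoduleOf (cycles P i) ≤
      ((boundaries P i).submoduleOf (cycles P i)).comap (cyclesMap i e) := by
  rintro ⟨_, hz⟩ ⟨c, rfl⟩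
  exact ⟨chainsMap (i + 1) e c, boundary_chainsMap _ e c⟩

/-- The map induced on reduced homology by an order automorphism. -/
def homologyMap (i : ℤ) (e : P ≃o P) : ReducedHomology P i →ₗ[ℤ] ReducedHomology P i :=
  Submodule.mapQ _ _ (cyclesMap i e) (boundaries_le_comap i e)

theorem chainsMap_one (i : ℤ) (c : Chains P i) : chainsMap i (1 : P ≃o P) c = c := by
  have : (Face.map (1 : P ≃o P) : Face P i → Face P i) = id := by
    funext s
    apply Subtype.ext
    exact Finset.map_refl
  simp [chainsMap, this]

theorem chainsMap_mul (i : ℤ) (e f : P ≃o P) (c : Chains P i) :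
    chainsMap i (e * f) c = chainsMap i e (chainsMap i f c) := by
  have : (Face.map (e * f) : Face P i → Face P i) = Face.map e ∘ Face.map f := by
    funext s
    apply Subtype.ext
    exact (Finset.map_map f.toEquiv.toEmbedding e.toEquiv.toEmbedding s.1).symm
  simp [chainsMap, this, Finsupp.mapDomain_comp]

/-- The representation of the automorphism group of `P` on its reduced homology. -/
def homologyRep (P : Type*) [PartialOrder P] (i : ℤ) :
    Representation ℤ (P ≃o P) (ReducedHomology P i) where
  toFun := homologyMap i
  map_one' := by
    refine LinearMap.ext fun z => ?_
    obtain ⟨z, rfl⟩ := Submodule.Quotient.mk_surjective _ z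
    have : cyclesMap i (1 : P ≃o P) z = z := Subtype.ext (chainsMap_one i z.1)
    exact congrArg (Submodule.Quotient.mk (p := (boundaries P i).submoduleOf (cycles P i))) this
  map_mul' e f := by
    refine LinearMap.ext fun z => ?_
    obtain ⟨z, rfl⟩ := Submodule.Quotient.mk_surjective _ z
    have : cyclesMap i (e * f) z = cyclesMap i e (cyclesMap i f z) :=
      Subtype.ext (chainsMap_mul i e f z.1)
    exact congrArg (Submodule.Quotient.mk (p := (boundaries P i).submoduleOf (cycles P i))) this

end

end OrderComplex

/-- The poset of proper nonzero subspaces of `V`, ordered by inclusion. -/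
abbrev TitsBuilding (F V : Type*) [Field F] [AddCommGroup V] [Module F V] : Type _ :=
  {W : Submodule F V // W ≠ ⊥ ∧ W ≠ ⊤}

namespace TitsBuilding

/-- An invertible linear map `g` acts on proper nonzero subspaces by `W ↦ g(W)`. -/
def automorphism {F V : Type*} [Field F] [AddCommGroup V] [Module F V] (g : V ≃ₗ[F] V) :
    TitsBuilding F V ≃o TitsBuilding F V where
  toEquiv := (Submodule.orderIsoMapComap g).toEquiv.subtypeEquiv fun W => by
    have h1 := map_eq_bot_iff (Submodule.orderIsoMapComap g) (a := W)
    have h2 := map_eq_top_iff (Submodule.orderIsoMapComap g) (a := W)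
    exact (and_congr (not_congr h1) (not_congr h2)).symm
  map_rel_iff' := (Submodule.orderIsoMapComap g).map_rel_iff'

/-- The action of the linear automorphisms of `V` on the building of `V`. -/
def action (F V : Type*) [Field F] [AddCommGroup V] [Module F V] :
    (V ≃ₗ[F] V) →* (TitsBuilding F V ≃o TitsBuilding F V) where
  toFun := automorphism
  map_one' := by
    ext W x
    exact Iff.of_eq (congrArg (x ∈ ·) (Submodule.map_id W.1))
  map_mul' g h := by
    ext W x
    exact Iff.of_eq (congrArg (x ∈ ·) (Submodule.map_comp h.toLinearMap g.toLinearMap W.1))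

end TitsBuilding

/-- The underlying abelian group of the integral Steinberg module: the reduced homology in degree
`n - 2` (an integer, so degree `-1` for `n = 1`) of the building of `Fⁿ`. -/
abbrev SteinbergModule (F : Type*) [Field F] (n : ℕ) : Type _ :=
  OrderComplex.ReducedHomology (TitsBuilding F (Fin n → F)) ((n : ℤ) - 2)

/-- The action of `GLₙ(F)` on the integral Steinberg module. -/
def steinbergRep (F : Type*) [Field F] (n : ℕ) :
    Representation ℤ (GL (Fin n) F) (SteinbergModule F n) :=
  (OrderComplex.homologyRep (TitsBuilding F (Fin n → F)) ((n : ℤ) - 2)).comp <|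
    (TitsBuilding.action F (Fin n → F)).comp <|
      (LinearMap.GeneralLinearGroup.generalLinearEquiv F (Fin n → F)).toMonoidHom.comp
        Matrix.GeneralLinearGroup.toLin.toMonoidHom

/-- For an integral representation `V` of `G` and a ring `R` (not necessarily commutative), the
tensor product of `R` and `V` over `ℤ`, to be regarded as a left module over the group
ring `R[G]`. -/
def ScalarExtension (R : Type*) [Ring R] {G V : Type*} [Group G] [AddCommGroup V] [Module ℤ V]
    (_ρ : Representation ℤ G V) : Type _ :=
  R ⊗[ℤ] V

namespace ScalarExtension

section

variable (R : Type*) [Ring R] {G V : Type*} [Group G] [AddCommGroup V] [Module ℤ V]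
  (ρ : Representation ℤ G V)

instance : AddCommGroup (ScalarExtension R ρ) := inferInstanceAs (AddCommGroup (R ⊗[ℤ] V))

instance : Module R (ScalarExtension R ρ) := inferInstanceAs (Module R (R ⊗[ℤ] V))

/-- The action of `G` on the tensor product through the second factor. -/
def groupAction : G →* AddMonoid.End (ScalarExtension R ρ) where
  toFun g := (LinearMap.lTensor R (ρ g)).toAddMonoidHom
  map_one' := by
    ext x
    change LinearMap.lTensor R (ρ 1) x = x
    rw [map_one]
    exact LinearMap.lTensor_id_apply _ _ _
  map_mul' g h := by
    ext x
    change LinearMap.lTensor R (ρ (g * h)) x = LinearMap.lTensor R (ρ g) (LinearMap.lTensor R (ρ h) x)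
    rw [map_mul]
    exact LinearMap.lTensor_comp_apply _ _ _ _

theorem commute (r : R) (g : G) :
    Commute (Module.toAddMonoidEnd R (ScalarExtension R ρ) r) (groupAction R ρ g) := by
  ext x
  have key : ∀ y : R ⊗[ℤ] V,
      r • LinearMap.lTensor R (ρ g) y = LinearMap.lTensor R (ρ g) (r • y) := fun y => by
    induction y using TensorProduct.induction_on with
    | zero => simp
    | tmul a v => simp [TensorProduct.smul_tmul']
    | add a b ha hb => simp only [smul_add, map_add, ha, hb]
  exact key x

/-- The left `R[G]`-module structure, with `(r g) • (a ⊗ v) = (r a) ⊗ (g v)`. -/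
instance : Module (MonoidAlgebra R G) (ScalarExtension R ρ) :=
  Module.compHom (ScalarExtension R ρ) <|
    MonoidAlgebra.liftNCRingHom (Module.toAddMonoidEnd R (ScalarExtension R ρ))
      (groupAction R ρ) (commute R ρ)

theorem single_smul_tmul (g : G) (r a : R) (v : V) :
    (MonoidAlgebra.single g r • (show ScalarExtension R ρ from a ⊗ₜ[ℤ] v)) =
      (show ScalarExtension R ρ from (r * a) ⊗ₜ[ℤ] (ρ g v)) := by
  change MonoidAlgebra.liftNCRingHom (Module.toAddMonoidEnd R (ScalarExtension R ρ))
      (groupAction R ρ) (commute R ρ) (MonoidAlgebra.single g r) _ = _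
  simp [MonoidAlgebra.liftNCRingHom]
  rfl

end

end ScalarExtension

end

/-!
The Steinberg module is shown to become a permutation module with free action when it is restricted
to a Sylow `p`-subgroup `P` of `GLₙ(F)`, where `p` is the characteristic of `F`. Since the index of
`P` divides `∏ (q ^ k - 1)`, which is invertible in `R`, projectivity passes from `P` to `GLₙ(F)`.

*Restriction to `P`.* A `p`-group acting linearly in characteristic `p` preserves a complete flag `E`
(`IsPGroup.exists_invariant_flag`). The building has dimension `n - 2`, so its top homology consists
of cycles, that is, of integral functions on the chambers (complete flags) whose alternating sums at
each codimension-one face vanish. Restriction to the chambers opposite to `E` is an isomorphism from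
the cycles to all finitely supported functions on these chambers (`TitsBuilding.homologyEquiv`):

* It is injective. A chamber that is not opposite to `E` has an ascent, a vertex such that all other
  chambers containing the remaining vertices are in more general position to `E`
  (`TitsBuilding.exists_complexity_lt`). By induction the cycle vanishes on those chambers, and then
  the cycle condition at their common face makes it vanish on the given one.
* It is surjective. A chamber opposite to `E` determines with `E` a frame of `V`, and the alternating
  sum of the `n!` chambers of this frame is a cycle, in which no other chamber is opposite to `E`
  (`TitsBuilding.exists_cycle`).

The isomorphism is `P`-equivariant, and `P` acts freely on the chambers opposite to `E`: an element
that fixes one acts diagonally on a frame, with eigenvalues of `p`-power order, hence equal to `1`.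

*From `P` to `GLₙ(F)`.* The projection of the permutation module to the span of a set of orbit
representatives is an endomorphism `θ` with `∑ h θ h⁻¹ = 1`, the sum being over `P`. Summing over the
whole group gives `∑ g θ g⁻¹ = [GLₙ(F) : P]` (`Representation.exists_sum_conj_eq_index`). After
division by the index, Higman's criterion (`MonoidAlgebra.projective_of_sum_conj`) applies.
-/

/-! ### Relative projectivity over a group ring -/

theorem MonoidAlgebra.single_smul_smul {R G M : Type*} [Ring R] [Group G] [AddCommGroup M]
    [Module R M] [Module (MonoidAlgebra R G) M] [IsScalarTower R (MonoidAlgebra R G) M]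
    (g : G) (r : R) (x : M) :
    (single g 1 : MonoidAlgebra R G) • r • x = r • (single g 1 : MonoidAlgebra R G) • x := by
  rw [← smul_one_smul (MonoidAlgebra R G) r x, smul_smul, ← smul_assoc]
  congr 1
  simp [MonoidAlgebra.one_def, MonoidAlgebra.single_mul_single]

theorem MonoidAlgebra.single_eq_smul_one {R G : Type*} [Ring R] [Group G] (g : G) (r : R) :
    (single g r : MonoidAlgebra R G) = r • single g 1 := by
  simp

/-- Higman's criterion: a module over a group ring that is projective over the coefficients is
projective if its identity is the trace `∑ g θ g⁻¹` of an `R`-linear endomorphism `θ`. -/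
theorem MonoidAlgebra.projective_of_sum_conj {R G M : Type*} [Ring R] [Group G] [Fintype G]
    [AddCommGroup M] [Module R M] [Module (MonoidAlgebra R G) M]
    [IsScalarTower R (MonoidAlgebra R G) M] [Module.Projective R M] (θ : M →ₗ[R] M)
    (hθ : ∀ x : M, ∑ g : G, (single g 1 : MonoidAlgebra R G) •
      θ ((single g⁻¹ 1 : MonoidAlgebra R G) • x) = x) :
    Module.Projective (MonoidAlgebra R G) M := by
  obtain ⟨s, hs⟩ := (Module.projective_def' (R := R) (P := M)).1 inferInstance
  let ι : (M →₀ R) →ₗ[R] (M →₀ MonoidAlgebra R G) :=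
    Finsupp.mapRange.linearMap (LinearMap.toSpanSingleton R (MonoidAlgebra R G) 1)
  have hι : ∀ y, Finsupp.linearCombination (MonoidAlgebra R G) (id : M → M) (ι y) =
      Finsupp.linearCombination R id y := by
    intro y
    induction y using Finsupp.induction_linear with
    | zero => simp
    | add a b ha hb => simp only [map_add, ha, hb]
    | single m r => simp [ι]
  -- `t` averages an `R`-linear section of the free cover of `M` over `G`, weighted by `θ`.
  let t : M → (M →₀ MonoidAlgebra R G) := fun x =>
    ∑ g : G, (single g 1 : MonoidAlgebra R G) •
      ι (s (θ ((single g⁻¹ 1 : MonoidAlgebra R G) • x)))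
  have ht_add : ∀ x y, t (x + y) = t x + t y := fun x y => by
    simp only [t, smul_add, map_add, Finset.sum_add_distrib]
  have ht_smul : ∀ (r : R) x, t (r • x) = r • t x := fun r x => by
    simp only [t, single_smul_smul, map_smul, Finset.smul_sum]
  have ht_single : ∀ (k : G) x, t ((single k 1 : MonoidAlgebra R G) • x) =
      (single k 1 : MonoidAlgebra R G) • t x := fun k x => by
    simp only [t, Finset.smul_sum, smul_smul, MonoidAlgebra.single_mul_single, mul_one]
    refine Fintype.sum_equiv (Equiv.mulLeft k⁻¹) _ _ fun g => ?_
    simp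
  rw [Module.projective_def']
  refine ⟨{ toFun := t, map_add' := ht_add, map_smul' := fun a x => ?_ }, LinearMap.ext fun x => ?_⟩
  · induction a using MonoidAlgebra.induction_linear with
    | zero => simpa using ht_smul 0 0
    | add a b ha hb => simp only [add_smul, ht_add, ha, hb, RingHom.id_apply]
    | single k r =>
      rw [single_eq_smul_one, smul_assoc, ht_smul, ht_single, RingHom.id_apply, smul_assoc]
  · have : ∀ y, Finsupp.linearCombination R id (s y) = y := LinearMap.congr_fun hs
    simp [t, hι, this, hθ]

namespace ScalarExtension

variable (R : Type*) [Ring R] {G V : Type*} [Group G] [AddCommGroup V]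
  (ρ : Representation ℤ G V)

@[elab_as_elim]
theorem induction_on {motive : ScalarExtension R ρ → Prop} (x : ScalarExtension R ρ)
    (zero : motive 0) (tmul : ∀ (a : R) (v : V), motive (show ScalarExtension R ρ from a ⊗ₜ[ℤ] v))
    (add : ∀ x y, motive x → motive y → motive (x + y)) : motive x :=
  TensorProduct.induction_on (motive := motive) x zero tmul add

instance isScalarTower : IsScalarTower R (MonoidAlgebra R G) (ScalarExtension R ρ) where
  smul_assoc r a x := by
    have key : ∀ (g : G) (b : R), MonoidAlgebra.single g (r * b) • x =
        r • (MonoidAlgebra.single g b • x) := fun g b => by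
      induction x using ScalarExtension.induction_on with
      | zero => simp only [smul_zero]
      | tmul c v =>
        refine (single_smul_tmul R ρ g (r * b) c v).trans ?_
        rw [single_smul_tmul, mul_assoc]
        rfl
      | add y z hy hz => simp only [smul_add, hy, hz]
    induction a using MonoidAlgebra.induction_linear with
    | zero => simp
    | add a b ha hb => simp only [smul_add, add_smul, ha, hb]
    | single g b => rw [MonoidAlgebra.smul_single]; exact key g b

/-- If `V` is free over `ℤ` and multiplication by `m` on `V` is the trace of an endomorphism, then
`R ⊗ V` is projective over `R[G]` as soon as `m` is invertible in `R`. -/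
theorem projective_of_sum_conj [Fintype G] [Module.Free ℤ V] (m : ℤ) (hm : IsUnit (m : R))
    (θ : V →ₗ[ℤ] V) (hθ : ∀ v, ∑ g : G, ρ g (θ (ρ g⁻¹ v)) = m • v) :
    Module.Projective (MonoidAlgebra R G) (ScalarExtension R ρ) := by
  obtain ⟨u, hu⟩ := hm
  have : Module.Free R (ScalarExtension R ρ) := inferInstanceAs (Module.Free R (R ⊗[ℤ] V))
  let Θ : ScalarExtension R ρ →ₗ[R] ScalarExtension R ρ :=
    (TensorProduct.AlgebraTensorModule.map (LinearMap.toSpanSingleton R R (↑u⁻¹ : R)) θ :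
      R ⊗[ℤ] V →ₗ[R] R ⊗[ℤ] V)
  refine MonoidAlgebra.projective_of_sum_conj Θ fun x => ?_
  induction x using ScalarExtension.induction_on with
  | zero => simp
  | tmul a v =>
    have key : ∀ g : G, (MonoidAlgebra.single g (1 : R) •
        Θ (MonoidAlgebra.single g⁻¹ (1 : R) • (show ScalarExtension R ρ from a ⊗ₜ[ℤ] v))) =
        (show ScalarExtension R ρ from (a * (↑u⁻¹ : R)) ⊗ₜ[ℤ] (ρ g (θ (ρ g⁻¹ v)))) := fun g => by
      rw [single_smul_tmul, one_mul]
      refine (single_smul_tmul R ρ g 1 (a * (↑u⁻¹ : R)) (θ (ρ g⁻¹ v))).trans ?_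
      rw [one_mul]
    refine (Finset.sum_congr rfl fun g _ => key g).trans ?_
    refine (TensorProduct.tmul_sum _ _ _).symm.trans ?_
    rw [hθ, ← TensorProduct.smul_tmul]
    congr 1
    rw [zsmul_eq_mul, (Int.cast_commute m (a * (↑u⁻¹ : R))).eq, ← hu, mul_assoc, Units.inv_mul,
      mul_one]
  | add y z hy hz => simp only [smul_add, map_add, Finset.sum_add_distrib, hy, hz]

end ScalarExtension

/-- If `V` restricted to a subgroup `H` is the permutation module on a set with free `H`-action,
then multiplication by the index of `H` is the trace of an endomorphism of `V`. -/
theorem Representation.exists_sum_conj_eq_index {G V X : Type*} [Group G] [Fintype G]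
    [AddCommGroup V] (ρ : Representation ℤ G V) (H : Subgroup G) [MulAction H X]
    (hfree : ∀ (h : H) (x : X), h • x = x → h = 1) (φ : V ≃ₗ[ℤ] (X →₀ ℤ))
    (hφ : ∀ (h : H) (v : V) (x : X), φ (ρ h v) (h • x) = φ v x) :
    ∃ θ : V →ₗ[ℤ] V, ∀ v, ∑ g : G, ρ g (θ (ρ g⁻¹ v)) = (H.index : ℤ) • v := by
  classical
  -- `T` is a set of representatives of the orbits.
  let T : Set X := Set.range (Quotient.out : MulAction.orbitRel.Quotient H X → X)
  have hT : ∀ x : X, ∃! h : H, h⁻¹ • x ∈ T := fun x => by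
    have hout : (Quotient.mk (MulAction.orbitRel H X) x).out ∈ MulAction.orbit H x :=
      Quotient.mk_out (s := MulAction.orbitRel H X) x
    obtain ⟨k, hk⟩ := hout
    refine ⟨k⁻¹, ⟨_, by simpa using hk.symm⟩, ?_⟩
    rintro l ⟨c, hc⟩
    have h1 : Quotient.mk (MulAction.orbitRel H X) x = c := by
      rw [← Quotient.out_eq c, hc]
      exact (Quotient.sound (s := MulAction.orbitRel H X) ⟨l⁻¹, rfl⟩ : _ = _).symm
    have h2 : (l * k) • x = x := by
      rw [mul_smul]
      change l • k • x = x
      have : k • x = l⁻¹ • x := by rw [← hc, ← h1]; exact hk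
      rw [this, smul_inv_smul]
    exact eq_inv_of_mul_eq_one_left (hfree _ _ h2)
  let cut : (X →₀ ℤ) →ₗ[ℤ] (X →₀ ℤ) :=
    { toFun := fun f => f.filter (· ∈ T)
      map_add' := fun _ _ => Finsupp.filter_add
      map_smul' := fun _ _ => Finsupp.filter_smul }
  let θ : V →ₗ[ℤ] V := φ.symm.toLinearMap ∘ₗ cut ∘ₗ φ.toLinearMap
  have hφ' : ∀ (h : H) (v : V) (x : X), φ (ρ h v) x = φ v (h⁻¹ • x) := fun h v x => by
    rw [← hφ h v (h⁻¹ • x), smul_inv_smul]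
  have hH : ∀ v, ∑ h : H, ρ h (θ (ρ (h : G)⁻¹ v)) = v := fun v => by
    apply φ.injective
    ext x
    rw [map_sum, Finsupp.finsetSum_apply]
    obtain ⟨k, hk, hk'⟩ := hT x
    have hterm : ∀ h : H, φ (ρ h (θ (ρ (h : G)⁻¹ v))) x = if h⁻¹ • x ∈ T then φ v x else 0 :=
      fun h => by
        rw [hφ']
        have : φ (θ (ρ (h : G)⁻¹ v)) = (φ (ρ (h : G)⁻¹ v)).filter (· ∈ T) :=
          φ.apply_symm_apply _
        rw [this, Finsupp.filter_apply]
        congr 1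
        exact hφ h⁻¹ v x
    simp only [hterm]
    rw [Finset.sum_eq_single k (fun h _ hne => if_neg fun hh => hne (hk' h hh)) (by simp),
      if_pos hk]
  refine ⟨θ, fun v => ?_⟩
  have hbij : Function.Bijective fun p : (G ⧸ H) × H => p.1.out * (p.2 : G) := by
    constructor
    · rintro ⟨c, h⟩ ⟨d, k⟩ hcd
      dsimp only at hcd
      have h1 : c = d := by
        have := congrArg (QuotientGroup.mk : G → G ⧸ H) hcd
        simpa [QuotientGroup.mk_mul_of_mem] using this
      subst h1
      simpa using hcd
    · intro g
      obtain ⟨h, hh⟩ := QuotientGroup.mk_out_eq_mul H g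
      exact ⟨(g, h⁻¹), by simp [hh]⟩
  -- Each coset contributes a conjugate of the identity.
  rw [← Function.Bijective.sum_comp hbij (fun g => ρ g (θ (ρ g⁻¹ v))), Fintype.sum_prod_type]
  have hc : ∀ c : G ⧸ H, ∑ h : H, ρ (c.out * (h : G)) (θ (ρ (c.out * (h : G))⁻¹ v)) = v :=
    fun c => by
      simp only [mul_inv_rev, map_mul, Module.End.mul_apply, ← map_sum, hH]
      rw [← Module.End.mul_apply, ← map_mul, mul_inv_cancel, map_one, Module.End.one_apply]
  simp only [hc]
  rw [Finset.sum_const, Finset.card_univ, ← Nat.card_eq_fintype_card, ← natCast_zsmul]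
  rfl

/-! ### Complete flags -/

/-- `E 0 ≤ E 1 ≤ ⋯ ≤ E n = V` is a complete flag: `E i` has dimension `i` for `i ≤ n`. The values
`E i` for `i > n` are forced to be `⊤` by monotonicity. -/
structure IsCompleteFlag {F V : Type*} [Field F] [AddCommGroup V] [Module F V] (n : ℕ)
    (E : ℕ → Submodule F V) : Prop where
  monotone : Monotone E
  finrank_eq : ∀ i ≤ n, Module.finrank F (E i) = i
  eq_top : E n = ⊤

/-- Two flags are opposite if complementary steps intersect trivially. -/
def IsOpposite {F V : Type*} [Field F] [AddCommGroup V] [Module F V] (n : ℕ)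
    (W E : ℕ → Submodule F V) : Prop :=
  ∀ i ≤ n, W i ⊓ E (n - i) = ⊥

section LinearAlgebra

variable {F V : Type*} [Field F] [AddCommGroup V] [Module F V] {n : ℕ}
  {E W : ℕ → Submodule F V}

open Module

namespace IsCompleteFlag

theorem finrank_space (hE : IsCompleteFlag n E) : finrank F V = n := by
  rw [← finrank_top, ← hE.eq_top, hE.finrank_eq n le_rfl]

theorem eq_bot [FiniteDimensional F V] (hE : IsCompleteFlag n E) : E 0 = ⊥ :=
  Submodule.finrank_eq_zero.1 (hE.finrank_eq 0 (Nat.zero_le n))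

theorem ne_bot_and_ne_top (hW : IsCompleteFlag n W)
    {i : ℕ} (h0 : 0 < i) (hi : i < n) : W i ≠ ⊥ ∧ W i ≠ ⊤ := by
  have hd := hW.finrank_eq i hi.le
  constructor
  · intro h
    rw [h, finrank_bot] at hd
    omega
  · intro h
    rw [h, finrank_top, hW.finrank_space] at hd
    omega

end IsCompleteFlag

variable [FiniteDimensional F V]

theorem Submodule.finrank_inf_add_le {A X : Submodule F V} (h : A ≤ X) (Y : Submodule F V) :
    finrank F (X ⊓ Y : Submodule F V) + finrank F A ≤
      finrank F (A ⊓ Y : Submodule F V) + finrank F X := by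
  have h1 := Submodule.finrank_sup_add_finrank_inf_eq (X ⊓ Y) A
  have h2 : X ⊓ Y ⊓ A = A ⊓ Y := by
    rw [inf_right_comm, inf_eq_right.2 h]
  have h3 : finrank F (X ⊓ Y ⊔ A : Submodule F V) ≤ finrank F X :=
    Submodule.finrank_mono (sup_le inf_le_left h)
  rw [h2] at h1
  omega

/-- A flag that is not opposite to `E` has an ascent: a step `W (i + 1)` which, among the subspaces
between its neighbours, is the one that meets `E a` in more than the others do. -/
theorem IsCompleteFlag.exists_ascent (hW : IsCompleteFlag n W) (hE : IsCompleteFlag n E)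
    (h : ¬ IsOpposite n W E) :
    ∃ i a, i + 1 < n ∧ a ≤ n ∧ W (i + 2) ⊓ E a ≤ W (i + 1) ∧ ¬ W (i + 1) ⊓ E a ≤ W i := by
  by_contra! H
  apply h
  -- If `W (i + 1)` meets `E a` inside `W i`, the absence of ascents carries this down to `W 0 = ⊥`.
  have descend : ∀ a ≤ n, ∀ i < n, W (i + 1) ⊓ E a ≤ W i → W (i + 1) ⊓ E a = ⊥ := by
    intro a ha i
    induction i with
    | zero =>
      intro _ h0
      rw [hW.eq_bot] at h0
      exact le_bot_iff.1 h0
    | succ i ih =>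
      intro hi h0
      have h1 := ih (by omega) (H i a hi ha h0)
      exact le_bot_iff.1 (h1 ▸ le_inf h0 inf_le_right)
  suffices ∀ k ≤ n, W (n - k) ⊓ E k = ⊥ by
    intro i hi
    have := this (n - i) (Nat.sub_le n i)
    rwa [Nat.sub_sub_self hi] at this
  intro k
  induction k with
  | zero => intro _; rw [hE.eq_bot, inf_bot_eq]
  | succ k ih =>
    intro hk
    have ih := ih (by omega)
    obtain ⟨i, hi⟩ : ∃ i, n - k = i + 1 := ⟨n - (k + 1), by omega⟩
    have hi' : n - (k + 1) = i := by omega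
    rw [hi] at ih
    rw [hi']
    by_contra hne
    -- `W (i + 1) ⊓ E (k + 1)` has dimension at most `1`, so it is already contained in `W i`.
    have h1 := Submodule.finrank_inf_add_le (hE.monotone k.le_succ : E k ≤ E (k + 1)) (W (i + 1))
    rw [inf_comm (E k), ih, hE.finrank_eq k (by omega), hE.finrank_eq (k + 1) hk, finrank_bot,
      inf_comm] at h1
    have h2 : finrank F (W i ⊓ E (k + 1) : Submodule F V) ≠ 0 := fun h0 =>
      hne (Submodule.finrank_eq_zero.1 h0)
    have h3 : W i ⊓ E (k + 1) ≤ W (i + 1) ⊓ E (k + 1) :=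
      inf_le_inf_right _ (hW.monotone (Nat.le_succ i))
    have h4 := Submodule.eq_of_le_of_finrank_le h3 (by omega)
    have h5 := descend (k + 1) hk i (by omega) (h4 ▸ inf_le_left)
    exact hne (h4.trans h5)

/-- At an ascent, replacing the middle step `X` by another subspace `X'` between its neighbours
brings the flag into more general position. -/
theorem finrank_inf_lt_of_ascent (hE : Monotone E) {A B X X' : Submodule F V} {a : ℕ}
    (hAX : A ≤ X) (hAX' : A ≤ X') (hX'B : X' ≤ B)
    (hX : finrank F X = finrank F A + 1) (hX' : finrank F X' = finrank F A + 1) (hne : X' ≠ X)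
    (h1 : B ⊓ E a ≤ X) (h2 : ¬ X ⊓ E a ≤ A) (j : ℕ) :
    finrank F (X' ⊓ E j : Submodule F V) ≤ finrank F (X ⊓ E j : Submodule F V) ∧
      (j = a → finrank F (X' ⊓ E j : Submodule F V) < finrank F (X ⊓ E j : Submodule F V)) := by
  have hA : X' ⊓ X ≤ A := by
    have hlt : X' ⊓ X < X' := lt_of_le_of_ne inf_le_left fun h =>
      hne (Submodule.eq_of_le_of_finrank_eq (inf_eq_left.1 h) (hX'.trans hX.symm))
    have := Submodule.finrank_lt_finrank_of_lt hlt
    exact (Submodule.eq_of_le_of_finrank_le (le_inf hAX' hAX) (by omega)).ge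
  have hlow : ∀ j ≤ a, X' ⊓ E j ≤ A ⊓ E j := fun j hj =>
    le_inf ((le_inf inf_le_left ((inf_le_inf hX'B (hE hj)).trans h1)).trans hA) inf_le_right
  have hhigh : ∀ j, a ≤ j → finrank F (A ⊓ E j : Submodule F V) <
      finrank F (X ⊓ E j : Submodule F V) := fun j hj => by
    refine Submodule.finrank_lt_finrank_of_lt (lt_of_le_of_ne (inf_le_inf_right _ hAX) fun h => ?_)
    exact h2 (((inf_le_inf_left X (hE hj)).trans h.ge).trans inf_le_left)
  constructor
  · rcases le_total j a with hj | hj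
    · exact Submodule.finrank_mono ((hlow j hj).trans (inf_le_inf_right _ hAX))
    · have := Submodule.finrank_inf_add_le hAX' (E j)
      have := hhigh j hj
      omega
  · rintro rfl
    exact (Submodule.finrank_mono (hlow j le_rfl)).trans_lt (hhigh j le_rfl)

/-- Two opposite flags are spanned by the initial and the final segments of one frame. -/
theorem IsCompleteFlag.exists_frame (hW : IsCompleteFlag n W) (hE : IsCompleteFlag n E)
    (h : IsOpposite n W E) :
    ∃ v : Fin n → V, LinearIndependent F v ∧ (∀ i : Fin n, v i ∈ E (n - i)) ∧
      ∀ k ≤ n, Submodule.span F (v '' {i | i.val < k}) = W k := by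
  have hex : ∀ i : Fin n, ∃ x ∈ W (i + 1) ⊓ E (n - i), x ≠ 0 := fun i => by
    refine (Submodule.ne_bot_iff _).1 fun h0 => ?_
    have h1 := Submodule.finrank_sup_add_finrank_inf_eq (W (i + 1)) (E (n - i))
    have h2 := Submodule.finrank_le (W (i + 1) ⊔ E (n - i))
    rw [h0, finrank_bot, hW.finrank_eq _ i.2, hE.finrank_eq _ (Nat.sub_le _ _)] at h1
    rw [hW.finrank_space] at h2
    omega
  choose v hv hv0 using hex
  have hvW : ∀ i : Fin n, v i ∉ W i := fun i hi => hv0 i <| by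
    have : v i ∈ W i ⊓ E (n - i) := ⟨hi, (hv i).2⟩
    rwa [h i i.2.le, Submodule.mem_bot] at this
  have hspan : ∀ k ≤ n, Submodule.span F (v '' {i | i.val < k}) = W k := by
    intro k
    induction k with
    | zero => intro _; simp [hW.eq_bot]
    | succ k ih =>
      intro hk
      have ih := ih (by omega)
      have hset : {i : Fin n | i.val < k + 1} = insert ⟨k, hk⟩ {i | i.val < k} := by
        ext i
        simp only [Set.mem_ofPred_eq, Set.mem_insert_iff, Fin.ext_iff]
        omega
      rw [hset, Set.image_insert_eq, Submodule.span_insert, ih]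
      refine Submodule.eq_of_le_of_finrank_le (sup_le ?_ (hW.monotone (Nat.le_succ k))) ?_
      · rw [Submodule.span_singleton_le_iff_mem]
        exact (hv ⟨k, hk⟩).1
      · rw [hW.finrank_eq (k + 1) hk]
        have hlt : W k < Submodule.span F {v ⟨k, hk⟩} ⊔ W k := by
          refine lt_of_le_of_ne le_sup_right fun h0 => hvW ⟨k, hk⟩ ?_
          change v ⟨k, hk⟩ ∈ W k
          rw [h0]
          exact Submodule.mem_sup_left (Submodule.mem_span_singleton_self _)
        have := Submodule.finrank_lt_finrank_of_lt hlt
        rw [hW.finrank_eq k (by omega)] at this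
        exact this
  refine ⟨v, ?_, fun i => (hv i).2, hspan⟩
  refine linearIndependent_of_top_le_span_of_card_eq_finrank ?_ ?_
  · rw [← hW.eq_top, ← hspan n le_rfl]
    exact Submodule.span_mono (Set.image_subset_range _ _)
  · rw [Fintype.card_fin, hW.finrank_space]

/-- The stabilizer of a pair of opposite flags is a torus, so that it has no nontrivial elements of
`p`-power order in characteristic `p`. -/
theorem IsCompleteFlag.eq_one_of_pow_eq_one (hW : IsCompleteFlag n W) (hE : IsCompleteFlag n E)
    (h : IsOpposite n W E) (p : ℕ) [ExpChar F p] (g : V ≃ₗ[F] V) {k : ℕ} (hg : g ^ p ^ k = 1)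
    (hgW : ∀ i ≤ n, ∀ x ∈ W i, g x ∈ W i) (hgE : ∀ i, ∀ x ∈ E i, g x ∈ E i) : g = 1 := by
  obtain ⟨v, hv, hvE, hspan⟩ := hW.exists_frame hE h
  have hvW : ∀ i : Fin n, v i ∈ W (i + 1) := fun i => by
    rw [← hspan _ i.2]
    exact Submodule.subset_span ⟨i, Nat.lt_succ_self _, rfl⟩
  have hfix : ∀ i, g (v i) = v i := fun i => by
    have hdim : finrank F (W (i + 1) ⊓ E (n - i) : Submodule F V) ≤ 1 := by
      have h1 := Submodule.finrank_inf_add_le (hW.monotone i.1.le_succ : W i ≤ W (i + 1)) (E (n - i))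
      rw [h i i.2.le, finrank_bot, hW.finrank_eq _ i.2.le, hW.finrank_eq _ i.2] at h1
      omega
    have hmem : v i ∈ W (i + 1) ⊓ E (n - i) := ⟨hvW i, hvE i⟩
    obtain ⟨w, hw⟩ := finrank_le_one_iff.1 hdim
    obtain ⟨a, ha⟩ := hw ⟨v i, hmem⟩
    obtain ⟨b, hb⟩ := hw ⟨g (v i), hgW _ i.2 _ (hvW i), hgE _ _ (hvE i)⟩
    replace ha : a • (w : V) = v i := congrArg Subtype.val ha
    replace hb : b • (w : V) = g (v i) := congrArg Subtype.val hb
    have ha0 : a ≠ 0 := by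
      rintro rfl
      exact hv.ne_zero i (by rw [← ha, zero_smul])
    have hc : g (v i) = (b / a) • v i := by
      rw [← hb, ← ha, smul_smul, div_mul_cancel₀ _ ha0]
    have hpow : ∀ m : ℕ, (g ^ m) (v i) = (b / a) ^ m • v i := fun m => by
      induction m with
      | zero => simp
      | succ m ih => rw [pow_succ, LinearEquiv.mul_apply, hc, map_smul, ih, smul_smul, pow_succ']
    have h1 := hpow (p ^ k)
    rw [hg, LinearEquiv.coe_one, id] at h1
    have h2 : (b / a) ^ p ^ k = 1 :=
      smul_left_injective F (hv.ne_zero i) (by simpa using h1.symm)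
    rw [← mul_one (p ^ k), ExpChar.pow_prime_pow_mul_eq_one_iff, pow_one] at h2
    rw [hc, h2, one_smul]
  have htop : ⊤ ≤ Submodule.span F (Set.range v) := by
    rw [← hW.eq_top, ← hspan n le_rfl]
    exact Submodule.span_mono (Set.image_subset_range _ _)
  apply LinearEquiv.toLinearMap_injective
  refine LinearMap.ext_on_range (v := v) (top_le_iff.1 htop) fun i => ?_
  simpa using hfix i

end LinearAlgebra

section PGroup

open Module

variable {F V : Type*} [Field F] [AddCommGroup V] [Module F V] [Finite V] {p : ℕ} [Fact p.Prime]
  [CharP F p] {P : Type*} [Group P]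

/-- A `p`-group acting linearly on a nonzero finite vector space in characteristic `p` fixes a
nonzero vector. -/
theorem IsPGroup.exists_ne_zero_fixed [Nontrivial V] (hP : IsPGroup p P) (ρ : Representation F P V) :
    ∃ x : V, x ≠ 0 ∧ ∀ g, ρ g x = x := by
  let _ : MulAction P V :=
    { smul := fun g x => ρ g x
      one_smul := fun x => by
        change ρ 1 x = x
        simp
      mul_smul := fun g h x => by
        change ρ (g * h) x = ρ g (ρ h x)
        simp }
  obtain ⟨y, hy⟩ := exists_ne (0 : V)
  have hord : addOrderOf y = p := addOrderOf_eq_prime (by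
    rw [← Nat.cast_smul_eq_nsmul F, CharP.cast_eq_zero, zero_smul]) hy
  have hdvd : p ∣ Nat.card V := hord ▸ addOrderOf_dvd_natCard y
  have h0 : (0 : V) ∈ MulAction.fixedPoints P V := fun g => map_zero (ρ g)
  obtain ⟨x, hx, hne⟩ := hP.exists_fixed_point_of_prime_dvd_card_of_fixed_point V hdvd h0
  exact ⟨x, hne.symm, hx⟩

/-- An invariant subspace is enlarged by a line that is fixed in the quotient. -/
theorem IsPGroup.exists_invariant_finrank_succ (hP : IsPGroup p P) (ρ : Representation F P V)
    (U : Submodule F V)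
    (hU : ∀ g, U ≤ U.comap (ρ g)) (hne : U ≠ ⊤) :
    ∃ U' : Submodule F V, U ≤ U' ∧ finrank F U' = finrank F U + 1 ∧ ∀ g, U' ≤ U'.comap (ρ g) := by
  have : Nontrivial (V ⧸ U) := Submodule.Quotient.nontrivial_iff.2 hne
  have : Finite (V ⧸ U) := Finite.of_surjective _ U.mkQ_surjective
  obtain ⟨y, hy, hfix⟩ := hP.exists_ne_zero_fixed (ρ.quotient U hU)
  obtain ⟨x, rfl⟩ := U.mkQ_surjective y
  have hxU : x ∉ U := fun hx => hy ((Submodule.Quotient.mk_eq_zero U).2 hx)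
  refine ⟨U ⊔ Submodule.span F {x}, le_sup_left, ?_, fun g => sup_le ?_ ?_⟩
  · rw [Submodule.finrank_sup_span_singleton hxU]
  · exact (hU g).trans (Submodule.comap_mono le_sup_left)
  · rw [Submodule.span_singleton_le_iff_mem, Submodule.mem_comap]
    have h1 : U.mkQ (ρ g x) = U.mkQ x := hfix g
    have h2 : ρ g x - x ∈ U := (Submodule.Quotient.eq U).1 h1
    rw [← sub_add_cancel (ρ g x) x]
    exact Submodule.add_mem_sup h2 (Submodule.mem_span_singleton_self x)

theorem IsPGroup.exists_invariant_flag (hP : IsPGroup p P) (ρ : Representation F P V) {n : ℕ}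
    (hn : finrank F V = n) :
    ∃ E : ℕ → Submodule F V, IsCompleteFlag n E ∧ ∀ g i, E i ≤ (E i).comap (ρ g) := by
  classical
  have hnext : ∀ U : {U : Submodule F V // ∀ g, U ≤ U.comap (ρ g)},
      ∃ U' : {U : Submodule F V // ∀ g, U ≤ U.comap (ρ g)}, U ≤ U' ∧
        (U.1 ≠ ⊤ → finrank F U'.1 = finrank F U.1 + 1) := fun U => by
    by_cases hU : U.1 = ⊤
    · exact ⟨U, le_rfl, fun h => absurd hU h⟩
    · obtain ⟨U', h1, h2, h3⟩ := hP.exists_invariant_finrank_succ ρ U.1 U.2 hU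
      exact ⟨⟨U', h3⟩, h1, fun _ => h2⟩
  choose next hle hrank using hnext
  let E : ℕ → {U : Submodule F V // ∀ g, U ≤ U.comap (ρ g)} := fun i =>
    Nat.rec ⟨⊥, fun _ => bot_le⟩ (fun _ U => next U) i
  have hE : ∀ i ≤ n, finrank F (E i).1 = i := fun i => by
    induction i with
    | zero => intro _; exact finrank_bot F V
    | succ i ih =>
      intro hi
      have ih := ih (by omega)
      refine (hrank (E i) fun h => ?_).trans (by rw [ih])
      rw [h, finrank_top, hn] at ih
      omega
  refine ⟨fun i => (E i).1, ⟨monotone_nat_of_le_succ fun i => hle (E i), hE, ?_⟩,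
    fun g i => (E i).2 g⟩
  exact Submodule.eq_top_of_finrank_eq ((hE n le_rfl).trans hn.symm)

end PGroup

/-! ### Chambers of the building -/

namespace OrderComplex

variable {P : Type*} [PartialOrder P] {i j : ℤ}

theorem boundary_single (h : j + 1 = i) (s : Face P i) :
    boundary P h (Finsupp.single s 1) = s.boundary h := by
  simp [boundary]

open Classical in
theorem Face.boundary_apply (h : j + 1 = i) (s : Face P i) (t : Face P j) :
    s.boundary h t = ∑ x : s.1, if s.erase h x = t then (-1 : ℤ) ^ s.position x else 0 := by
  unfold Face.boundary
  rw [Finsupp.finsetSum_apply]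
  refine Finset.sum_congr rfl fun x _ => ?_
  rw [Finsupp.smul_apply, Finsupp.single_apply, smul_eq_mul, mul_ite, mul_one, mul_zero]

theorem Face.erase_injective (h : j + 1 = i) (s : Face P i) :
    Function.Injective (s.erase h) := by
  classical
  intro x y hxy
  apply Subtype.ext
  have h1 : s.1.erase x = s.1.erase y := by
    have := congrArg Subtype.val hxy
    unfold Face.erase at this
    convert this
  by_contra hne
  exact Finset.notMem_erase x.1 s.1 (h1 ▸ Finset.mem_erase.2 ⟨hne, x.2⟩)

theorem Face.mem_erase (h : j + 1 = i) (s : Face P i) (x : s.1) (y : P) :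
    y ∈ (s.erase h x).1 ↔ y ≠ x ∧ y ∈ s.1 := by
  classical
  unfold Face.erase
  exact Finset.mem_erase

/-- A cycle that vanishes on all faces which share with `s` the facet opposite to one of its
vertices, except possibly `s`, vanishes on `s` as well. -/
theorem eq_zero_of_isolated (h : j + 1 = i) {z : Chains P i} (hz : boundary P h z = 0)
    (s : Face P i) (x : s.1)
    (hx : ∀ (s' : Face P i) (x' : s'.1), s'.erase h x' = s.erase h x → s' ≠ s → z s' = 0) :
    z s = 0 := by
  classical
  have h1 : boundary P h z (s.erase h x) = z s * (-1) ^ s.position x := by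
    unfold boundary
    rw [Finsupp.linearCombination_apply, Finsupp.sum_apply, Finsupp.sum,
      Finset.sum_eq_single s]
    · rw [Finsupp.smul_apply, Face.boundary_apply, smul_eq_mul, Finset.sum_eq_single x]
      · rw [if_pos rfl]
      · exact fun y _ hy => if_neg fun hh => hy (s.erase_injective h hh)
      · simp
    · intro s' _ hs'
      rw [Finsupp.smul_apply, Face.boundary_apply, Finset.smul_sum]
      refine Finset.sum_eq_zero fun x' _ => ?_
      split_ifs with hh
      · rw [hx s' x' hh hs', zero_smul]
      · rw [smul_zero]
    · intro hs
      rw [Finsupp.notMem_support_iff.1 hs, zero_smul, Finsupp.zero_apply]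
  rw [hz, Finsupp.zero_apply] at h1
  exact (mul_eq_zero.1 h1.symm).resolve_right (pow_ne_zero _ (by norm_num))

end OrderComplex

namespace TitsBuilding

open Module OrderComplex

variable {F V : Type*} [Field F] [AddCommGroup V] [Module F V] [FiniteDimensional F V] {n : ℕ}

theorem finrank_pos (X : TitsBuilding F V) : 0 < finrank F X.1 :=
  Nat.pos_of_ne_zero fun h => X.2.1 (Submodule.finrank_eq_zero.1 h)

theorem finrank_lt (X : TitsBuilding F V) : finrank F X.1 < finrank F V :=
  Submodule.finrank_lt X.2.2

theorem finrank_injOn {s : Finset (TitsBuilding F V)}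
    (hs : IsChain (· ≤ ·) (s : Set (TitsBuilding F V))) :
    Set.InjOn (fun X : TitsBuilding F V => finrank F X.1) s := by
  intro X hX Y hY h
  by_contra hne
  rcases hs hX hY hne with hXY | hXY
  · exact hne (Subtype.ext (Submodule.eq_of_le_of_finrank_eq hXY h))
  · exact hne (Subtype.ext (Submodule.eq_of_le_of_finrank_eq hXY h.symm).symm)

theorem card_chain_le {s : Finset (TitsBuilding F V)}
    (hs : IsChain (· ≤ ·) (s : Set (TitsBuilding F V))) :
    s.card ≤ finrank F V - 1 := by
  classical
  rw [← Finset.card_image_of_injOn (finrank_injOn hs)]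
  refine (Finset.card_le_card (t := Finset.Ioo 0 (finrank F V)) fun i hi => ?_).trans (by simp)
  obtain ⟨X, -, rfl⟩ := Finset.mem_image.1 hi
  exact Finset.mem_Ioo.2 ⟨finrank_pos X, finrank_lt X⟩

/-- The building has no faces above dimension `n - 2`. -/
theorem boundaries_eq_bot (hn : finrank F V = n) :
    boundaries (TitsBuilding F V) ((n : ℤ) - 2) = ⊥ := by
  rw [eq_bot_iff]
  rintro _ ⟨c, rfl⟩
  rw [Submodule.mem_bot]
  ext t
  -- For `n = 0` there is a face of degree `n - 1`, the empty one, but none of degree `n - 2`.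
  have ht := t.2.2
  have : IsEmpty (Face (TitsBuilding F V) ((n : ℤ) - 2 + 1)) := ⟨fun s => by
    have h1 := s.2.2
    have h2 := card_chain_le s.2.1
    omega⟩
  rw [Subsingleton.elim c 0, map_zero]

/-- The vertices of a chamber are the proper nonzero terms of a complete flag. -/
theorem exists_flag (hn : finrank F V = n) (s : Face (TitsBuilding F V) ((n : ℤ) - 2)) :
    ∃ W : ℕ → Submodule F V, IsCompleteFlag n W ∧
      ∀ X : TitsBuilding F V, X ∈ s.1 ↔ X.1 = W (finrank F X.1) := by
  classical
  have hcard := s.2.2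
  -- The `n - 1` vertices have distinct dimensions between `0` and `n`, so each of them occurs.
  have himage : s.1.image (fun X => finrank F X.1) = Finset.Ioo 0 n := by
    refine Finset.eq_of_subset_of_card_le (fun i hi => ?_) ?_
    · obtain ⟨X, -, rfl⟩ := Finset.mem_image.1 hi
      exact Finset.mem_Ioo.2 ⟨finrank_pos X, hn ▸ finrank_lt X⟩
    · rw [Finset.card_image_of_injOn (finrank_injOn s.2.1), Nat.card_Ioo]
      omega
  let S : Set (Submodule F V) := {U | U = ⊥ ∨ U = ⊤ ∨ ∃ X ∈ s.1, X.1 = U}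
  have hS : ∀ U ∈ S, ∀ U' ∈ S, U ≤ U' ∨ U' ≤ U := by
    rintro U (rfl | rfl | ⟨X, hX, rfl⟩) U' (rfl | rfl | ⟨X', hX', rfl⟩)
    any_goals simp
    exact s.2.1.total hX hX'
  have hle : ∀ U ∈ S, ∀ U' ∈ S, finrank F U ≤ finrank F U' → U ≤ U' := fun U hU U' hU' h =>
    (hS U hU U' hU').elim id fun h' => (Submodule.eq_of_le_of_finrank_le h' h).ge
  have hex : ∀ i, ∃ U ∈ S, finrank F U = min i n := fun i => by
    rcases Nat.eq_zero_or_pos (min i n) with h0 | h0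
    · exact ⟨⊥, Or.inl rfl, by rw [h0, finrank_bot]⟩
    rcases (min_le_right i n).eq_or_lt with h1 | h1
    · exact ⟨⊤, Or.inr (Or.inl rfl), by rw [h1, finrank_top, hn]⟩
    have h2 : min i n ∈ s.1.image (fun X => finrank F X.1) := himage ▸ Finset.mem_Ioo.2 ⟨h0, h1⟩
    obtain ⟨X, hX, hXi⟩ := Finset.mem_image.1 h2
    exact ⟨X.1, Or.inr (Or.inr ⟨X, hX, rfl⟩), hXi⟩
  choose W hW hWi using hex
  refine ⟨W, ⟨fun i j hij => hle _ (hW i) _ (hW j) ?_, fun i hi => ?_, ?_⟩,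
    fun X => ⟨fun hX => ?_, ?_⟩⟩
  · rw [hWi, hWi]
    exact min_le_min_right n hij
  · rw [hWi, min_eq_left hi]
  · exact Submodule.eq_top_of_finrank_eq (by rw [hWi, min_self, hn])
  · have hXS : X.1 ∈ S := Or.inr (Or.inr ⟨X, hX, rfl⟩)
    have h1 : finrank F (W (finrank F X.1)) = finrank F X.1 := by
      rw [hWi, min_eq_left (hn ▸ (finrank_lt X).le)]
    exact le_antisymm (hle _ hXS _ (hW _) h1.ge) (hle _ (hW _) _ hXS h1.le)
  · intro hi
    rcases hW (finrank F X.1) with h | h | ⟨Y, hY, h⟩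
    · exact absurd (hi.trans h) X.2.1
    · exact absurd (hi.trans h) X.2.2
    · rwa [Subtype.ext (hi.trans h.symm)]

/-- A chamber is opposite to the flag `E` if each of its vertices is complementary to the term of
`E` of complementary dimension. -/
def Opposite (n : ℕ) (E : ℕ → Submodule F V) (s : Face (TitsBuilding F V) ((n : ℤ) - 2)) : Prop :=
  ∀ X ∈ s.1, X.1 ⊓ E (n - finrank F X.1) = ⊥

theorem opposite_iff {E W : ℕ → Submodule F V} (hE : IsCompleteFlag n E)
    (hW : IsCompleteFlag n W) {s : Face (TitsBuilding F V) ((n : ℤ) - 2)}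
    (hs : ∀ X : TitsBuilding F V, X ∈ s.1 ↔ X.1 = W (finrank F X.1)) :
    Opposite n E s ↔ IsOpposite n W E := by
  constructor
  · intro h i hi
    rcases Nat.eq_zero_or_pos i with rfl | h0
    · rw [hW.eq_bot, bot_inf_eq]
    rcases hi.eq_or_lt with rfl | hi'
    · rw [Nat.sub_self, hE.eq_bot, inf_bot_eq]
    have hd := hW.finrank_eq i hi
    have := h ⟨W i, hW.ne_bot_and_ne_top h0 hi'⟩ ((hs _).2 (by rw [hd]))
    rwa [hd] at this
  · intro h X hX
    have := h (finrank F X.1) (hE.finrank_space ▸ (finrank_lt X).le)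
    rwa [← (hs X).1 hX] at this

/-- The sum of the dimensions of the intersections of the terms of a chamber with those of the flag
`E`. It is smallest for the chambers in general position to `E`. -/
noncomputable def complexity (n : ℕ) (E : ℕ → Submodule F V)
    (s : Face (TitsBuilding F V) ((n : ℤ) - 2)) : ℕ :=
  ∑ X ∈ s.1, ∑ j ∈ Finset.range (n + 1), finrank F (X.1 ⊓ E j : Submodule F V)

/-- A chamber that is not opposite to `E` has a vertex such that replacing it always brings the
chamber into more general position to `E`. -/
theorem exists_complexity_lt {E : ℕ → Submodule F V} (hE : IsCompleteFlag n E) {j : ℤ}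
    (h : j + 1 = (n : ℤ) - 2) (s : Face (TitsBuilding F V) ((n : ℤ) - 2)) (hs : ¬ Opposite n E s) :
    ∃ X : s.1, ∀ (s' : Face (TitsBuilding F V) ((n : ℤ) - 2)) (X' : s'.1),
      s'.erase h X' = s.erase h X → s' ≠ s → complexity n E s' < complexity n E s := by
  classical
  obtain ⟨W, hW, hsW⟩ := exists_flag hE.finrank_space s
  rw [opposite_iff hE hW hsW] at hs
  obtain ⟨i, a, hi, ha, h1, h2⟩ := hW.exists_ascent hE hs
  have hdim := hW.finrank_eq (i + 1) hi.le
  let X : TitsBuilding F V := ⟨W (i + 1), hW.ne_bot_and_ne_top i.succ_pos hi⟩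
  have hXs : X ∈ s.1 := (hsW X).2 (by rw [hdim])
  refine ⟨⟨X, hXs⟩, fun s' ⟨X', hX's⟩ herase hne => ?_⟩
  have hmem : ∀ Y : TitsBuilding F V, (Y ≠ X' ∧ Y ∈ s'.1) ↔ (Y ≠ X ∧ Y ∈ s.1) := fun Y => by
    rw [← s'.mem_erase h ⟨X', hX's⟩, ← s.mem_erase h ⟨X, hXs⟩, herase]
  obtain ⟨W', hW', hsW'⟩ := exists_flag hE.finrank_space s'
  -- The two flags agree except in dimension `i + 1`.
  have hagree : ∀ k ≤ n, k ≠ i + 1 → W' k = W k := by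
    intro k hk hki
    rcases Nat.eq_zero_or_pos k with rfl | h0
    · rw [hW.eq_bot, hW'.eq_bot]
    rcases hk.eq_or_lt with rfl | hk'
    · rw [hW.eq_top, hW'.eq_top]
    have hd := hW.finrank_eq k hk
    let Y : TitsBuilding F V := ⟨W k, hW.ne_bot_and_ne_top h0 hk'⟩
    have hYX : Y ≠ X := fun h0 => hki <| by
      rw [← hd, ← hdim]
      exact congrArg (fun Z : TitsBuilding F V => finrank F Z.1) h0
    have hYs' := ((hmem Y).2 ⟨hYX, (hsW Y).2 (by rw [hd])⟩).2
    have := (hsW' Y).1 hYs'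
    rw [hd] at this
    exact this.symm
  have hXX' : X' ≠ X := by
    rintro rfl
    refine hne (Subtype.ext (Finset.ext fun Y => ?_))
    by_cases hY : Y = X
    · rw [hY]
      exact iff_of_true hX's hXs
    · have := hmem Y
      tauto
  have hl := (hsW' X').1 hX's
  have hli : finrank F X'.1 = i + 1 := by
    by_contra hli
    rw [hagree _ (hE.finrank_space ▸ (finrank_lt X').le) hli] at hl
    exact ((hmem X').2 ⟨hXX', (hsW X').2 hl⟩).1 rfl
  rw [hli] at hl
  have hcompare := finrank_inf_lt_of_ascent hE.monotone (A := W i) (B := W (i + 2)) (X := X.1)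
    (X' := X'.1) (a := a) (hW.monotone i.le_succ)
    (by rw [hl, ← hagree i (by omega) (by omega)]; exact hW'.monotone i.le_succ)
    (by rw [hl, ← hagree (i + 2) (by omega) (by omega)]; exact hW'.monotone (i + 1).le_succ)
    (by rw [hW.finrank_eq i (by omega)]; exact hdim)
    (by rw [hW.finrank_eq i (by omega), hli])
    (fun h0 => hXX' (Subtype.ext h0)) h1 h2
  have hset : s'.1.erase X' = s.1.erase X := Finset.ext fun Y => by
    rw [Finset.mem_erase, Finset.mem_erase]
    exact hmem Y
  unfold complexity
  rw [← Finset.add_sum_erase s'.1 _ hX's, ← Finset.add_sum_erase s.1 _ hXs, hset]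
  refine Nat.add_lt_add_right (Finset.sum_lt_sum (fun k _ => (hcompare k).1) ⟨a, ?_, ?_⟩) _
  · exact Finset.mem_range.2 (by omega)
  · exact (hcompare a).2 rfl

/-- A cycle of top degree is determined by its values on the chambers opposite to `E`. -/
theorem eq_zero_of_opposite {E : ℕ → Submodule F V} (hE : IsCompleteFlag n E) {j : ℤ}
    (h : j + 1 = (n : ℤ) - 2) {z : Chains (TitsBuilding F V) ((n : ℤ) - 2)}
    (hz : boundary (TitsBuilding F V) h z = 0) (hopp : ∀ s, Opposite n E s → z s = 0) : z = 0 := by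
  suffices ∀ (m : ℕ) s, complexity n E s = m → z s = 0 from Finsupp.ext fun s => this _ s rfl
  intro m
  induction m using Nat.strong_induction_on with
  | _ m ih =>
    rintro s rfl
    by_cases hs : Opposite n E s
    · exact hopp s hs
    · obtain ⟨X, hX⟩ := exists_complexity_lt hE h s hs
      exact eq_zero_of_isolated h hz s X fun s' X' h1 h2 => ih _ (hX s' X' h1 h2) s' rfl

end TitsBuilding

/-! ### Apartments -/

namespace TitsBuilding

open Module OrderComplex

variable {F V : Type*} [Field F] [AddCommGroup V] [Module F V] {n : ℕ}
  {E W : ℕ → Submodule F V}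

/-- The flag spanned by the initial segments of a frame in the order given by `σ`. -/
def frameFlag (v : Fin n → V) (σ : Equiv.Perm (Fin n)) (k : ℕ) : Submodule F V :=
  Submodule.span F ((v ∘ σ) '' {i | i.val < k})

theorem frameFlag_mul_swap (v : Fin n → V) (σ : Equiv.Perm (Fin n)) {k l : ℕ} (hk : k < n)
    (hlk : l ≠ k) : frameFlag (F := F) v (σ * Equiv.swap ⟨k - 1, by omega⟩ ⟨k, hk⟩) l =
      frameFlag v σ l := by
  unfold frameFlag
  rw [Equiv.Perm.coe_mul, ← Function.comp_assoc, Set.image_comp (v ∘ σ)]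
  congr 2
  rw [Equiv.image_eq_preimage_symm, Equiv.symm_swap]
  ext i
  change (Equiv.swap _ _ i).val < l ↔ i.val < l
  rw [Equiv.swap_apply_def]
  split_ifs with h1 h2
  · rw [h1]
    dsimp only
    omega
  · rw [h2]
    dsimp only
    omega
  · rfl

variable [FiniteDimensional F V]

open Classical in
/-- The chamber whose vertices are the proper nonzero terms of a complete flag. For `n = 0` there are
no faces of degree `n - 2`, whence the positivity assumption. -/
noncomputable def chamber (h0 : 0 < n) (hW : IsCompleteFlag n W) :
    Face (TitsBuilding F V) ((n : ℤ) - 2) :=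
  ⟨Finset.univ.image fun k : Finset.Ioo 0 n =>
      (⟨W k, hW.ne_bot_and_ne_top (Finset.mem_Ioo.1 k.2).1 (Finset.mem_Ioo.1 k.2).2⟩ :
        TitsBuilding F V), by
    intro X hX Y hY _
    obtain ⟨k, -, rfl⟩ := Finset.mem_image.1 (Finset.mem_coe.1 hX)
    obtain ⟨l, -, rfl⟩ := Finset.mem_image.1 (Finset.mem_coe.1 hY)
    exact (le_total k.1 l.1).imp (fun h => hW.monotone h) (fun h => hW.monotone h), by
    rw [Finset.card_image_of_injective, Finset.card_univ, Fintype.card_coe, Nat.card_Ioo]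
    · omega
    · intro k l hkl
      apply Subtype.ext
      rw [← hW.finrank_eq k (Finset.mem_Ioo.1 k.2).2.le,
        ← hW.finrank_eq l (Finset.mem_Ioo.1 l.2).2.le]
      exact congrArg (fun X : TitsBuilding F V => finrank F X.1) hkl⟩

theorem mem_chamber (h0 : 0 < n) (hW : IsCompleteFlag n W) (X : TitsBuilding F V) :
    X ∈ (chamber h0 hW).1 ↔ X.1 = W (finrank F X.1) := by
  classical
  have hX := Finset.mem_Ioo.2 ⟨finrank_pos X, hW.finrank_space ▸ finrank_lt X⟩
  constructor
  · intro h
    obtain ⟨k, -, rfl⟩ := Finset.mem_image.1 h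
    exact congrArg W (hW.finrank_eq k (Finset.mem_Ioo.1 k.2).2.le).symm
  · intro h
    exact Finset.mem_image.2 ⟨⟨_, hX⟩, Finset.mem_univ _, Subtype.ext h.symm⟩

section

variable {s : Face (TitsBuilding F V) ((n : ℤ) - 2)}

theorem position_eq (hW : IsCompleteFlag n W)
    (hs : ∀ X : TitsBuilding F V, X ∈ s.1 ↔ X.1 = W (finrank F X.1)) {X : TitsBuilding F V}
    (hX : X ∈ s.1) : s.position X = finrank F X.1 - 1 := by
  classical
  have hXn : finrank F X.1 < n := hW.finrank_space ▸ finrank_lt X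
  unfold Face.position
  rw [← Finset.card_image_of_injOn
    ((finrank_injOn s.2.1).mono (Finset.coe_subset.2 (Finset.filter_subset _ _))),
    show finrank F X.1 - 1 = (Finset.Ioo 0 (finrank F X.1)).card by simp]
  congr 1
  ext k
  rw [Finset.mem_image, Finset.mem_Ioo]
  constructor
  · rintro ⟨Y, hY, rfl⟩
    exact ⟨finrank_pos Y, Submodule.finrank_lt_finrank_of_lt (Finset.mem_filter.1 hY).2⟩
  · rintro ⟨hk0, hkX⟩
    have hk := hW.finrank_eq k (hkX.trans hXn).le
    refine ⟨⟨W k, hW.ne_bot_and_ne_top hk0 (hkX.trans hXn)⟩, Finset.mem_filter.2 ⟨?_, ?_⟩, hk⟩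
    · exact (hs _).2 (by rw [hk])
    · have hle : W k ≤ X.1 := by
        rw [(hs X).1 hX]
        exact hW.monotone hkX.le
      refine lt_of_le_of_ne hle fun h => ?_
      have : W k = X.1 := congrArg Subtype.val h
      rw [this] at hk
      omega

/-- The vertex of dimension `k` of the chamber of a complete flag. -/
def vertex (hW : IsCompleteFlag n W)
    (hs : ∀ X : TitsBuilding F V, X ∈ s.1 ↔ X.1 = W (finrank F X.1)) (k : Finset.Ioo 0 n) : s.1 :=
  ⟨⟨W k, hW.ne_bot_and_ne_top (Finset.mem_Ioo.1 k.2).1 (Finset.mem_Ioo.1 k.2).2⟩,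
    (hs _).2 (congrArg W (hW.finrank_eq k (Finset.mem_Ioo.1 k.2).2.le).symm)⟩

theorem boundary_eq (hW : IsCompleteFlag n W)
    (hs : ∀ X : TitsBuilding F V, X ∈ s.1 ↔ X.1 = W (finrank F X.1)) {j : ℤ}
    (h : j + 1 = (n : ℤ) - 2) :
    s.boundary h = ∑ k : Finset.Ioo 0 n,
      (-1 : ℤ) ^ (k.1 - 1) • Finsupp.single (s.erase h (vertex hW hs k)) 1 := by
  unfold Face.boundary
  have hk : ∀ k : Finset.Ioo 0 n, finrank F (vertex hW hs k).1.1 = k := fun k =>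
    hW.finrank_eq k (Finset.mem_Ioo.1 k.2).2.le
  refine (Fintype.sum_bijective (vertex hW hs) ⟨fun k l hkl => ?_, fun X => ?_⟩ _ _ fun k => ?_).symm
  · exact Subtype.ext (by rw [← hk k, ← hk l, hkl])
  · exact ⟨⟨_, Finset.mem_Ioo.2 ⟨finrank_pos X.1, hW.finrank_space ▸ finrank_lt X.1⟩⟩,
      Subtype.ext (Subtype.ext ((hs X.1).1 X.2).symm)⟩
  · rw [position_eq hW hs (vertex hW hs k).2, hk]

end

theorem isCompleteFlag_frameFlag (hn : finrank F V = n) {v : Fin n → V}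
    (hv : LinearIndependent F v) (σ : Equiv.Perm (Fin n)) :
    IsCompleteFlag n (frameFlag (F := F) v σ) := by
  have hfin : ∀ k ≤ n, finrank F (frameFlag (F := F) v σ k) = k := fun k hk => by
    have hli : LinearIndependent F fun i : {i : Fin n | i.val < k} => (v ∘ σ) i :=
      (hv.comp σ σ.injective).comp _ Subtype.val_injective
    have h1 := finrank_span_eq_card hli
    rw [← Set.image_eq_range] at h1
    refine h1.trans ((Fintype.card_subtype fun i : Fin n => i.val < k).trans ?_)
    rw [Fin.card_filter_val_lt, min_eq_right hk]
  refine ⟨fun i j hij => Submodule.span_mono (Set.image_mono fun k hk => ?_), hfin, ?_⟩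
  · exact lt_of_lt_of_le hk hij
  · exact Submodule.eq_top_of_finrank_eq ((hfin n le_rfl).trans hn.symm)

/-- The apartment of a frame: the alternating sum of the chambers of its orderings. -/
noncomputable def apartment (h0 : 0 < n) (hn : finrank F V = n) {v : Fin n → V}
    (hv : LinearIndependent F v) : Chains (TitsBuilding F V) ((n : ℤ) - 2) :=
  ∑ σ : Equiv.Perm (Fin n), (Equiv.Perm.sign σ : ℤ) •
    Finsupp.single (chamber h0 (isCompleteFlag_frameFlag hn hv σ)) 1

theorem boundary_apartment (h0 : 0 < n) (hn : finrank F V = n) {v : Fin n → V}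
    (hv : LinearIndependent F v) {j : ℤ} (h : j + 1 = (n : ℤ) - 2) :
    boundary (TitsBuilding F V) h (apartment h0 hn hv) = 0 := by
  classical
  unfold apartment
  simp only [map_sum, map_smul, boundary_single,
    boundary_eq (isCompleteFlag_frameFlag hn hv _) (mem_chamber h0 _), Finset.smul_sum]
  rw [Finset.sum_comm]
  refine Finset.sum_eq_zero fun k _ => ?_
  have hk := Finset.mem_Ioo.1 k.2
  -- Orderings that differ by exchanging the entries `k - 1` and `k` have the same facet opposite
  -- to the vertex of dimension `k`.
  have hne : (⟨k.1 - 1, by omega⟩ : Fin n) ≠ ⟨k.1, hk.2⟩ := fun h => by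
    have := congrArg Fin.val h
    dsimp only at this
    omega
  refine Finset.sum_involution (fun σ _ => σ * Equiv.swap ⟨k.1 - 1, by omega⟩ ⟨k.1, hk.2⟩)
    (fun σ _ => ?_) (fun σ _ _ hσ => ?_) (fun _ _ => Finset.mem_univ _) (fun σ _ => ?_)
  · have hmem : ∀ (τ : Equiv.Perm (Fin n)) (Y : TitsBuilding F V),
        Y ∈ ((chamber h0 (isCompleteFlag_frameFlag hn hv τ)).erase h
          (vertex (isCompleteFlag_frameFlag hn hv τ) (mem_chamber h0 _) k)).1 ↔
        finrank F Y.1 ≠ k ∧ Y.1 = frameFlag v τ (finrank F Y.1) := fun τ Y => by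
      rw [Face.mem_erase, mem_chamber]
      refine and_congr_left fun hY => not_congr ?_
      have hfk := (isCompleteFlag_frameFlag (F := F) hn hv τ).finrank_eq k hk.2.le
      constructor
      · intro hYk
        have : Y.1 = frameFlag v τ k := congrArg Subtype.val hYk
        rw [this, hfk]
      · intro hYk
        rw [hYk] at hY
        exact Subtype.ext hY
    have hface : ∀ τ : Equiv.Perm (Fin n), τ = σ * Equiv.swap ⟨k.1 - 1, by omega⟩ ⟨k.1, hk.2⟩ →
        (chamber h0 (isCompleteFlag_frameFlag hn hv τ)).erase h
          (vertex (isCompleteFlag_frameFlag hn hv τ) (mem_chamber h0 _) k) =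
        (chamber h0 (isCompleteFlag_frameFlag hn hv σ)).erase h
          (vertex (isCompleteFlag_frameFlag hn hv σ) (mem_chamber h0 _) k) := by
      rintro τ rfl
      refine Subtype.ext (Finset.ext fun Y => ?_)
      rw [hmem, hmem]
      refine and_congr_right fun hY => ?_
      rw [frameFlag_mul_swap v σ hk.2 hY]
    rw [hface _ rfl, ← add_smul, Equiv.Perm.sign_mul, Equiv.Perm.sign_swap hne]
    simp
  · exact hne (Equiv.swap_eq_one_iff.1 (mul_eq_left.1 hσ))
  · rw [mul_assoc, Equiv.swap_mul_self, mul_one]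

theorem _root_.Equiv.Perm.eq_one_of_le {σ : Equiv.Perm (Fin n)} (h : ∀ i, σ i ≤ i) : σ = 1 := by
  refine Equiv.ext fun i => ?_
  induction i using WellFoundedLT.induction with
  | _ i ih =>
    rcases (h i).eq_or_lt with h1 | h1
    · exact h1
    · exact absurd (σ.injective (ih _ h1)) h1.ne

/-- Every chamber opposite to `E` lies in an apartment all of whose other chambers are not opposite
to `E`. -/
theorem exists_cycle (hE : IsCompleteFlag n E) {j : ℤ} (h : j + 1 = (n : ℤ) - 2)
    (s : Face (TitsBuilding F V) ((n : ℤ) - 2)) (hs : Opposite n E s) :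
    ∃ z : Chains (TitsBuilding F V) ((n : ℤ) - 2), boundary (TitsBuilding F V) h z = 0 ∧ z s = 1 ∧
      ∀ s', Opposite n E s' → s' ≠ s → z s' = 0 := by
  classical
  have hn := hE.finrank_space
  have h0 : 0 < n := by
    have := s.2.2
    omega
  obtain ⟨W, hW, hsW⟩ := exists_flag hn s
  obtain ⟨v, hv, hvE, hvW⟩ := hW.exists_frame hE ((opposite_iff hE hW hsW).1 hs)
  have hone : chamber h0 (isCompleteFlag_frameFlag hn hv 1) = s := by
    refine Subtype.ext (Finset.ext fun X => ?_)
    rw [mem_chamber, hsW, ← hvW _ (hn ▸ (finrank_lt X).le)]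
    rfl
  have hopp : ∀ σ, Opposite n E (chamber h0 (isCompleteFlag_frameFlag hn hv σ)) → σ = 1 := by
    intro σ hσ
    rw [opposite_iff hE (isCompleteFlag_frameFlag hn hv σ) (mem_chamber h0 _)] at hσ
    refine Equiv.Perm.eq_one_of_le fun i => ?_
    by_contra hi
    -- If `i < σ i`, the vector `v (σ i)` lies in two terms of complementary dimensions.
    have h1 : v (σ i) ∈ frameFlag (F := F) v σ (i + 1) ⊓ E (n - (i + 1)) := by
      refine ⟨Submodule.subset_span ⟨i, Nat.lt_succ_self _, rfl⟩, ?_⟩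
      refine hE.monotone ?_ (hvE (σ i))
      have : i.val < (σ i).val := not_le.1 hi
      omega
    rw [hσ (i + 1) i.2, Submodule.mem_bot] at h1
    exact hv.ne_zero _ h1
  have hval : ∀ s', Opposite n E s' → apartment h0 hn hv s' = if s = s' then 1 else 0 := by
    intro s' hs'
    unfold apartment
    rw [Finsupp.finsetSum_apply, Finset.sum_eq_single 1]
    · rw [hone, Finsupp.smul_apply, Finsupp.single_apply]
      simp
    · intro σ _ hσ
      rw [Finsupp.smul_apply, Finsupp.single_apply, if_neg, smul_zero]
      rintro rfl
      exact hσ (hopp σ hs')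
    · simp
  refine ⟨apartment h0 hn hv, boundary_apartment h0 hn hv h, ?_, fun s' hs' hne => ?_⟩
  · rw [hval s hs, if_pos rfl]
  · rw [hval s' hs', if_neg hne.symm]

end TitsBuilding

/-! ### The Steinberg module as a permutation module for a `p`-group -/

namespace OrderComplex

variable {P : Type*} [PartialOrder P]

theorem Face.mem_map (e : P ≃o P) {i : ℤ} (s : Face P i) (x : P) : e x ∈ (s.map e).1 ↔ x ∈ s.1 :=
  Finset.mem_map' e.toEquiv.toEmbedding

theorem Face.map_injective (e : P ≃o P) (i : ℤ) :
    Function.Injective (Face.map e : Face P i → Face P i) := fun _ _ h =>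
  Subtype.ext (Finset.map_injective _ (congrArg Subtype.val h))

instance Face.mulAction (i : ℤ) : MulAction (P ≃o P) (Face P i) where
  smul e s := s.map e
  one_smul _ := Subtype.ext Finset.map_refl
  mul_smul e f s := Subtype.ext
    (Finset.map_map f.toEquiv.toEmbedding e.toEquiv.toEmbedding s.1).symm

end OrderComplex

namespace TitsBuilding

open Module OrderComplex

variable {F V : Type*} [Field F] [AddCommGroup V] [Module F V] {n : ℕ} {E : ℕ → Submodule F V}

theorem automorphism_val (g : V ≃ₗ[F] V) (X : TitsBuilding F V) :
    (automorphism g X).1 = X.1.map g.toLinearMap :=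
  rfl

theorem finrank_automorphism (g : V ≃ₗ[F] V) (X : TitsBuilding F V) :
    finrank F (automorphism g X).1 = finrank F X.1 :=
  LinearEquiv.finrank_map_eq g X.1

theorem Opposite.map (g : V ≃ₗ[F] V) (hg : ∀ i, (E i).map g.toLinearMap = E i)
    {s : Face (TitsBuilding F V) ((n : ℤ) - 2)} (hs : Opposite n E s) :
    Opposite n E (s.map (automorphism g)) := by
  intro Y hY
  obtain ⟨X, rfl⟩ := (automorphism g).surjective Y
  rw [Face.mem_map] at hY
  rw [finrank_automorphism, automorphism_val, ← hg (n - _),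
    ← Submodule.map_inf _ g.injective, hs X hY, Submodule.map_bot]

variable [FiniteDimensional F V]

/-- A `p`-group that preserves `E` acts freely on the chambers opposite to `E`. -/
theorem eq_one_of_map_eq (hE : IsCompleteFlag n E) (p : ℕ) [ExpChar F p] {g : V ≃ₗ[F] V} {k : ℕ}
    (hpow : g ^ p ^ k = 1) (hg : ∀ i, (E i).map g.toLinearMap = E i)
    {s : Face (TitsBuilding F V) ((n : ℤ) - 2)} (hs : Opposite n E s)
    (hfix : s.map (automorphism g) = s) : g = 1 := by
  obtain ⟨W, hW, hsW⟩ := exists_flag hE.finrank_space s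
  refine hW.eq_one_of_pow_eq_one hE ((opposite_iff hE hW hsW).1 hs) p g hpow (fun i hi x hx => ?_)
    (fun i x hx => hg i ▸ Submodule.mem_map_of_mem hx)
  rcases Nat.eq_zero_or_pos i with rfl | h0
  · rw [hW.eq_bot, Submodule.mem_bot] at hx ⊢
    rw [hx, map_zero]
  rcases hi.eq_or_lt with rfl | hi'
  · rw [hW.eq_top]
    trivial
  have hd := hW.finrank_eq i hi
  let X : TitsBuilding F V := ⟨W i, hW.ne_bot_and_ne_top h0 hi'⟩
  have h1 : automorphism g X ∈ s.1 := hfix ▸ (s.mem_map _ X).2 ((hsW X).2 (by rw [hd]))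
  rw [hsW, finrank_automorphism, automorphism_val, hd] at h1
  rw [← h1]
  exact Submodule.mem_map_of_mem hx

/-- Top-dimensional cycles restrict isomorphically to the chambers opposite to `E`. -/
theorem restriction_bijective (hE : IsCompleteFlag n E) :
    Function.Bijective ((Finsupp.lsubtypeDomain (R := ℤ) {s | Opposite n E s}) ∘ₗ
      (cycles (TitsBuilding F V) ((n : ℤ) - 2)).subtype) := by
  constructor
  · rw [← LinearMap.ker_eq_bot, eq_bot_iff]
    intro z hz
    refine Subtype.ext (eq_zero_of_opposite hE _ z.2 fun s hs => ?_)
    exact DFunLike.congr_fun (LinearMap.mem_ker.1 hz) ⟨s, hs⟩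
  · rw [← LinearMap.range_eq_top, eq_top_iff]
    rintro f -
    induction f using Finsupp.induction_linear with
    | zero => exact zero_mem _
    | add f g hf hg => exact add_mem hf hg
    | single s a =>
      obtain ⟨z, hz, hz1, hz0⟩ := exists_cycle hE (sub_add_cancel ((n : ℤ) - 2) 1) s.1 s.2
      refine ⟨a • ⟨z, hz⟩, ?_⟩
      rw [map_smul]
      ext t
      change a • z t.1 = _
      by_cases hts : t = s
      · rw [hts, hz1, Finsupp.single_eq_same, smul_eq_mul, mul_one]
      · rw [hz0 t.1 t.2 fun h => hts (Subtype.ext h), smul_zero, Finsupp.single_eq_of_ne hts]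

/-- The top reduced homology of the building is free on the chambers opposite to `E`. -/
noncomputable def homologyEquiv (hE : IsCompleteFlag n E) :
    ReducedHomology (TitsBuilding F V) ((n : ℤ) - 2) ≃ₗ[ℤ]
      ({s : Face (TitsBuilding F V) ((n : ℤ) - 2) | Opposite n E s} →₀ ℤ) :=
  (Submodule.quotEquivOfEqBot _ (by
    rw [boundaries_eq_bot hE.finrank_space, Submodule.submoduleOf, Submodule.comap_bot,
      Submodule.ker_subtype])).trans (LinearEquiv.ofBijective _ (restriction_bijective hE))

theorem homologyEquiv_mk (hE : IsCompleteFlag n E)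
    (z : cycles (TitsBuilding F V) ((n : ℤ) - 2))
    (s : {s : Face (TitsBuilding F V) ((n : ℤ) - 2) | Opposite n E s}) :
    homologyEquiv hE (Submodule.Quotient.mk z) s = z.1 s.1 :=
  rfl

theorem homologyEquiv_homologyRep (hE : IsCompleteFlag n E)
    (e : TitsBuilding F V ≃o TitsBuilding F V)
    (c : ReducedHomology (TitsBuilding F V) ((n : ℤ) - 2))
    (s t : {s : Face (TitsBuilding F V) ((n : ℤ) - 2) | Opposite n E s}) (hst : t.1 = s.1.map e) :
    homologyEquiv hE (homologyRep _ _ e c) t = homologyEquiv hE c s := by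
  obtain ⟨z, rfl⟩ := Submodule.Quotient.mk_surjective _ c
  rw [homologyEquiv_mk]
  refine (homologyEquiv_mk hE (cyclesMap _ e z) t).trans ?_
  rw [hst]
  exact Finsupp.mapDomain_apply (Face.map_injective e _) z.1 s.1

/-- The top homology of the building is free over `ℤ`, and for a finite group `G` of linear
automorphisms of `V`, multiplication by the index of a Sylow `p`-subgroup is the trace of one of its
endomorphisms. -/
theorem exists_sum_conj_eq_index [Finite V] {p : ℕ} [Fact p.Prime] [CharP F p]
    (hn : finrank F V = n) {G : Type*} [Group G] [Fintype G] (f : G →* (V ≃ₗ[F] V))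
    (hf : Function.Injective f) (P : Sylow p G) :
    Module.Free ℤ (ReducedHomology (TitsBuilding F V) ((n : ℤ) - 2)) ∧
    ∃ θ : ReducedHomology (TitsBuilding F V) ((n : ℤ) - 2) →ₗ[ℤ]
        ReducedHomology (TitsBuilding F V) ((n : ℤ) - 2),
      ∀ c, ∑ g : G, homologyRep _ _ (action F V (f g))
        (θ (homologyRep _ _ (action F V (f g⁻¹)) c)) =
          ((P : Subgroup G).index : ℤ) • c := by
  let τ : Representation F P V :=
    (LinearEquiv.automorphismGroup.toLinearMapMonoidHom).comp (f.comp (P : Subgroup G).subtype)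
  obtain ⟨E, hE, hτ⟩ := P.isPGroup'.exists_invariant_flag τ hn
  have hPE : ∀ (g : P) i, (E i).map (f g).toLinearMap = E i := fun g i =>
    Submodule.eq_of_le_of_finrank_eq (Submodule.map_le_iff_le_comap.2 (hτ g i))
      (LinearEquiv.finrank_map_eq (f g) (E i))
  have : ExpChar F p := ExpChar.prime Fact.out
  let _ : MulAction P {s : Face (TitsBuilding F V) ((n : ℤ) - 2) | Opposite n E s} :=
    { smul := fun g s => ⟨action F V (f g) • s.1, Opposite.map (f g) (hPE g) s.2⟩
      one_smul := fun s => Subtype.ext (by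
        change action F V (f (1 : G)) • s.1 = s.1
        rw [map_one, map_one, one_smul])
      mul_smul := fun g h s => Subtype.ext (by
        change action F V (f (g * h : G)) • s.1 = action F V (f g) • action F V (f h) • s.1
        rw [map_mul, map_mul, mul_smul]) }
  refine ⟨Module.Free.of_equiv (homologyEquiv hE).symm, ?_⟩
  refine Representation.exists_sum_conj_eq_index
    ((homologyRep (TitsBuilding F V) ((n : ℤ) - 2)).comp ((action F V).comp f)) (P : Subgroup G)
    (fun g s hgs => ?_) (homologyEquiv hE) (fun g c s => ?_)
  · obtain ⟨k, hk⟩ := P.isPGroup' g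
    have hfk : f (g : G) ^ p ^ k = 1 := by
      rw [← map_pow, ← SubgroupClass.coe_pow, hk, OneMemClass.coe_one, map_one]
    have h1 := eq_one_of_map_eq hE p hfk (hPE g) s.2 (congrArg Subtype.val hgs)
    exact Subtype.ext (hf (h1.trans (map_one f).symm))
  · exact homologyEquiv_homologyRep hE _ c s _ rfl

end TitsBuilding

/-! ### The index of a Sylow subgroup of the general linear group -/

theorem Matrix.card_GL_field_eq (F : Type*) [Field F] [Finite F] (n : ℕ) :
    (Nat.card (GL (Fin n) F) : ℤ) = (Nat.card F : ℤ) ^ (∑ i ∈ Finset.range n, i) *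
      ∏ k ∈ Finset.Icc 1 n, ((Nat.card F : ℤ) ^ k - 1) := by
  let _ := Fintype.ofFinite F
  have hq : 1 ≤ Fintype.card F := Fintype.card_pos
  rw [Matrix.card_GL_field, Nat.card_eq_fintype_card,
    Fin.prod_univ_eq_prod_range (fun i => Fintype.card F ^ n - Fintype.card F ^ i),
    ← Finset.prod_pow_eq_pow_sum, ← Finset.Ico_add_one_right_eq_Icc, Finset.prod_Ico_eq_prod_range,
    ← Finset.prod_range_reflect (fun k => _ ^ (1 + k) - 1), Nat.add_sub_cancel,
    ← Finset.prod_mul_distrib]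
  push_cast
  refine Finset.prod_congr rfl fun i hi => ?_
  have hi := Finset.mem_range.1 hi
  rw [Nat.cast_sub (Nat.pow_le_pow_right hq hi.le), mul_sub, mul_one, ← pow_add]
  push_cast
  congr 2
  omega

theorem Sylow.index_GL_dvd {F : Type*} [Field F] [Finite F] {p : ℕ} [Fact p.Prime] [CharP F p]
    (n : ℕ) (P : Sylow p (GL (Fin n) F)) :
    ((P : Subgroup (GL (Fin n) F)).index : ℤ) ∣
      ∏ k ∈ Finset.Icc 1 n, ((Nat.card F : ℤ) ^ k - 1) := by
  let _ := Fintype.ofFinite F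
  obtain ⟨m, -, hm⟩ := FiniteField.card F p
  have hcop : IsCoprime ((P : Subgroup (GL (Fin n) F)).index : ℤ)
      ((Nat.card F : ℤ) ^ (∑ i ∈ Finset.range n, i)) := by
    refine IsCoprime.pow_right ?_
    rw [Nat.card_eq_fintype_card, hm, Nat.isCoprime_iff_coprime]
    exact (((Fact.out : p.Prime).coprime_iff_not_dvd.2 P.not_dvd_index).symm).pow_right _
  refine hcop.dvd_of_dvd_mul_left ?_
  rw [← Matrix.card_GL_field_eq]
  exact Int.natCast_dvd_natCast.2 (Subgroup.index_dvd_card _)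

/-! ### Projectivity of the Steinberg module -/

theorem mainTheorem7 (F : Type*) [Field F] [Finite F] (q : ℕ) (hq : Nat.card F = q) (n : ℕ)
    (R : Type*) [Ring R]
    (hR : IsUnit ((∏ k ∈ Finset.Icc 1 n, ((q : ℤ) ^ k - 1) : ℤ) : R)) :
    Module.Projective (MonoidAlgebra R (GL (Fin n) F)) (ScalarExtension R (steinbergRep F n)) := by
  subst hq
  obtain ⟨p, hp⟩ := CharP.exists F
  have : Fact p.Prime := ⟨CharP.char_is_prime F p⟩
  let _ := Fintype.ofFinite (GL (Fin n) F)
  let P : Sylow p (GL (Fin n) F) := default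
  let e : GL (Fin n) F ≃* ((Fin n → F) ≃ₗ[F] (Fin n → F)) :=
    Matrix.GeneralLinearGroup.toLin.trans
      (LinearMap.GeneralLinearGroup.generalLinearEquiv F (Fin n → F))
  obtain ⟨hfree, θ, hθ⟩ := TitsBuilding.exists_sum_conj_eq_index (F := F) (V := Fin n → F)
    (Module.finrank_fin_fun F) e.toMonoidHom e.injective P
  refine ScalarExtension.projective_of_sum_conj R (steinbergRep F n)
    ((P : Subgroup (GL (Fin n) F)).index : ℤ) ?_ θ hθ
  obtain ⟨m, hm⟩ := Sylow.index_GL_dvd n P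
  rw [hm, Int.cast_mul] at hR
  exact ((Int.cast_commute _ _).isUnit_mul_iff.1 hR).1
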